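/- Let $n\ge 0$ and let $\tilde W_n$ be the group of signed permutations $e_i\mapsto \pm e_{\pi(i)}$ of $\mathbb{Z}^n$, i.e. the Coxeter group of type $B_n$ with generators $t$ (sign change of $e_1$; $t=1$ if $n=0$) and $s_i$ (interchange of $e_i$ and $e_{i+1}$, $1\le i\le n-1$), and let $\tilde\ell$ be its length function. Let $W_n\subseteq\tilde W_n$ be the subgroup generated by $u=ts_1t$ (if $n\ge 2$) and $s_1,\dots,s_{n-1}$, the Coxeter group of type $D_n$, with root system $\Phi=\{\pm e_i\pm e_j\mid i\ne j\}$ and simple roots $e_1+e_2$ and $e_{i+1}-e_i$ ($1\le i\le n-1$). Put $w^\diamond=twt$ for $w\in W_n$ and $\alpha^\diamond=t(\alpha)$ for $\alpha\in\Phi$. Let $\delta$ be either $\diamond$ or the identity (on $W_n$ and on $\Phi$). Two elements $w,w'\in W_n$ are $\delta$-conjugate if $w'=\delta(x)wx^{-1}$ for some $x\in W_n$, and $w\in W_n$ is a $\delta$-twisted involution if $\delta(w)=w^{-1}$. For such a $w$ let $C^\delta(w)=\{x\in W_n\mid \delta(x)w=wx\}$, let $\Phi_w=\{\alpha\in\Phi\mid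 w(\alpha)=-\delta(\alpha)\}$, and for $x\in C^\delta(w)$ let $\varepsilon_w(x)=(-1)^k$ where $k$ is the number of positive $\alpha\in\Phi_w$ with $x(\alpha)$ negative. Kottwitz' character is $\Upsilon_w^\delta=\mathrm{Ind}_{C^\delta(w)}^{W_n}(\varepsilon_w)$; it is written $\Upsilon_w^1$ (split case) if $\delta$ is the identity and $\Upsilon_w^\diamond$ (quasi-split case) if $\delta=\diamond$. It depends only on the $\delta$-conjugacy class $C$ of $w$, and is also written $\Upsilon_C^\delta$. Let $\mathcal C$ be a conjugacy class of elements $\sigma\in\tilde W_n$ with $\sigma^2=1$, and let $\tilde M$ be a $\mathbb{Q}$-vector space with a basis $\{\tilde a_\sigma\mid\sigma\in\mathcal C\}$. Then there is a unique $\mathbb{Q}[\tilde W_n]$-module structure on $\tilde M$ such that $$t.\tilde a_\sigma=\tilde a_{t\sigma t},\qquad s_i.\tilde a_\sigma=\begin{cases}-\tilde a_\sigma&\text{if } s_i\sigma=\sigma s_i\text{ and }\tilde\ell(\sigma s_i)<\tilde\ell(\sigma),\\ \tilde a_{s_i\sigma s_i}&\text{otherwise,}\end{cases}$$ for all $\sigma\in\mathcal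 C$ and $1\le i\le n-1$. Let $\tilde\Upsilon_{\mathcal C}$ be the character of $\tilde W_n$ afforded by $\tilde M$. (a) If $\mathcal C\subseteq W_n$ and $\mathcal C$ is a single conjugacy class of $W_n$, then the restriction of $\tilde\Upsilon_{\mathcal C}$ to $W_n$ is $\Upsilon^1_{\mathcal C}$. (b) If $\mathcal C\subseteq W_n$ and $\mathcal C$ consists of two conjugacy classes of $W_n$, then $n$ is even and the restriction of $\tilde\Upsilon_{\mathcal C}$ to $W_n$ is $\Upsilon^1_{\sigma_{n/2}}+\Upsilon^1_{t\sigma_{n/2}t}$, where $\sigma_{n/2}=s_1s_3\cdots s_{n-1}$. (c) If $\mathcal C\subseteq W_nt$, then $C=\{t\sigma\mid\sigma\in\mathcal C\}$ is a $\diamond$-conjugacy class of $\diamond$-twisted involutions in $W_n$, and the restriction of $\tilde\Upsilon_{\mathcal C}$ to $W_n$ is $\Upsilon^\diamond_C$. -/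

import Mathlib

/-! ## Twisted involutions and Kottwitz' characters, for a finite group with a root system -/

namespace Kottwitz

section General

variable {W V : Type*} [Group W] [AddCommGroup V]

/-- `w` and `w'` are `δ`-conjugate: `w' = δ(x) w x⁻¹` for some `x`. -/
def IsTwistedConj (δ : W ≃* W) (w w' : W) : Prop :=
  ∃ x : W, w' = δ x * w * x⁻¹

/-- `K` is a single `δ`-conjugacy class. -/
def IsTwistedConjClass (δ : W ≃* W) (K : Set W) : Prop :=
  ∃ w : W, K = {w' | IsTwistedConj δ w w'}

/-- `w` is a `δ`-twisted involution: `δ(w) = w⁻¹`. -/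
def IsTwistedInvolution (δ : W ≃* W) (w : W) : Prop :=
  δ w = w⁻¹

/-- The `δ`-centraliser `{x | δ(x) w = w x}` of `w`. -/
def twistedCentralizer (δ : W ≃* W) (w : W) : Subgroup W where
  carrier := {x | δ x * w = w * x}
  mul_mem' := by
    intro x y hx hy
    simp only [Set.mem_ofPred_eq] at hx hy ⊢
    rw [map_mul, mul_assoc, hy, ← mul_assoc, hx, mul_assoc]
  one_mem' := by simp
  inv_mem' := by
    intro x hx
    simp only [Set.mem_ofPred_eq] at hx ⊢
    rw [map_inv, inv_mul_eq_iff_eq_mul, ← mul_assoc, hx, mul_inv_cancel_right]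

/-- The set `Φ_w` of roots `α` with `w(α) = -θ(α)`. Here `W` acts on `V ⊇ Φ` through `r`, and
`θ` is the map induced on roots by the automorphism of `W`. -/
def twistedRoots (r : Representation ℤ W V) (θ : V → V) (Φ : Set V) (w : W) : Set V :=
  {α | α ∈ Φ ∧ r w α = -θ α}

/-- The sign `(-1)^k`, where `k` is the number of positive roots `α ∈ Φ_w` such that `x(α)` is
negative. -/
noncomputable def kottwitzSign (r : Representation ℤ W V) (θ : V → V) (Φ pos : Set V)
    (w x : W) : ℚ :=
  (-1) ^ Set.ncard {α | α ∈ twistedRoots r θ Φ w ∧ α ∈ pos ∧ -(r x α) ∈ pos}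

open Classical in
/-- The class function on `G` induced from a class function `ψ` on the subgroup `H`
(for a finite group `G`). -/
noncomputable def inducedClassFunction {G : Type*} [Group G] (H : Subgroup G) (ψ : H → ℚ)
    (g : G) : ℚ :=
  (Nat.card H : ℚ)⁻¹ * ∑ᶠ x : G, if h : x⁻¹ * g * x ∈ H then ψ ⟨x⁻¹ * g * x, h⟩ else 0

/-- Kottwitz' character `Υ_w^δ`: the class function on `W` induced from the sign character of the
`δ`-centraliser of `w`. -/
noncomputable def kottwitzCharacter (δ : W ≃* W) (r : Representation ℤ W V) (θ : V → V)
    (Φ pos : Set V) (w : W) : W → ℚ :=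
  inducedClassFunction (twistedCentralizer δ w) fun x => kottwitzSign r θ Φ pos w (x : W)

end General

end Kottwitz

/-! ## The Coxeter group of type `B_n` as the group of signed permutations -/

/-- A signed permutation of `n` letters: the linear map `e_i ↦ sign i • e_{perm i}`. -/
@[ext]
structure SignedPerm (n : ℕ) where
  perm : Equiv.Perm (Fin n)
  sign : Fin n → ℤˣ

namespace SignedPerm

variable {n : ℕ}

/-- Composition of signed permutations, as linear maps. -/
instance : Mul (SignedPerm n) :=
  ⟨fun v w => ⟨v.perm * w.perm, fun i => v.sign (w.perm i) * w.sign i⟩⟩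

instance : One (SignedPerm n) := ⟨⟨1, fun _ => 1⟩⟩

instance : Inv (SignedPerm n) := ⟨fun w => ⟨w.perm⁻¹, fun i => (w.sign (w.perm⁻¹ i))⁻¹⟩⟩

@[simp] theorem mul_perm (v w : SignedPerm n) : (v * w).perm = v.perm * w.perm := rfl
@[simp] theorem mul_sign (v w : SignedPerm n) (i : Fin n) :
    (v * w).sign i = v.sign (w.perm i) * w.sign i := rfl
@[simp] theorem one_perm : (1 : SignedPerm n).perm = 1 := rfl
@[simp] theorem one_sign (i : Fin n) : (1 : SignedPerm n).sign i = 1 := rfl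
@[simp] theorem inv_perm (w : SignedPerm n) : (w⁻¹).perm = w.perm⁻¹ := rfl
@[simp] theorem inv_sign (w : SignedPerm n) (i : Fin n) :
    (w⁻¹).sign i = (w.sign (w.perm⁻¹ i))⁻¹ := rfl

instance : Group (SignedPerm n) :=
  Group.ofLeftAxioms
    (fun a b c => by ext i <;> simp [mul_assoc])
    (fun a => by ext i <;> simp)
    (fun a => by ext i <;> simp)

/-- The reflection representation on `ℤⁿ`: `w(e_i) = sign i • e_{perm i}`. -/
def reflectionRep (n : ℕ) : Representation ℤ (SignedPerm n) (Fin n → ℤ) where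
  toFun w :=
    { toFun := fun v j => (w.sign (w.perm⁻¹ j) : ℤ) * v (w.perm⁻¹ j)
      map_add' := fun v v' => by ext j; simp [mul_add]
      map_smul' := fun c v => by ext j; simp [mul_left_comm] }
  map_one' := by ext i j; simp
  map_mul' v w := by
    refine LinearMap.ext fun x => funext fun j => ?_
    simp [mul_assoc]

/-- The generator `t`: the sign change of the first basis vector. -/
def t (n : ℕ) : SignedPerm n := ⟨1, fun i => if (i : ℕ) = 0 then -1 else 1⟩

/-- The generators `s_1, …, s_{n-1}`, indexed from `0`: `s i` interchanges the basis vectors with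
(zero-based) indices `i` and `i + 1`. -/
def s (i : Fin (n - 1)) : SignedPerm n :=
  ⟨Equiv.swap ⟨i, by omega⟩ ⟨i + 1, by omega⟩, fun _ => 1⟩

/-- The set of generators `{t, s_1, …, s_{n-1}}`. -/
def generators (n : ℕ) : Set (SignedPerm n) := {t n} ∪ Set.range s

/-- The length with respect to `t, s_1, …, s_{n-1}`: the least length of a word in the generators
with product `w`. -/
noncomputable def length (w : SignedPerm n) : ℕ :=
  sInf {k | ∃ l : List (SignedPerm n), (∀ g ∈ l, g ∈ generators n) ∧ l.prod = w ∧ l.length = k}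

/-! ### The subgroup of type `D_n` and its root system -/

/-- The generators `u = t s_1 t` (present only if `n ≥ 2`) and `s_1, …, s_{n-1}`. -/
def dGenerators (n : ℕ) : Set (SignedPerm n) :=
  {w | ∃ h : 0 < n - 1, w = t n * s ⟨0, h⟩ * t n} ∪ Set.range s

/-- The Coxeter group `W_n` of type `D_n`, as a subgroup of the group of type `B_n`. -/
def D (n : ℕ) : Subgroup (SignedPerm n) := Subgroup.closure (dGenerators n)

theorem t_mul_t (n : ℕ) : t n * t n = 1 := by
  ext i
  · simp [t]
  · by_cases h : (i : ℕ) = 0 <;> simp [t, h]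

theorem t_conj_mem {w : SignedPerm n} (hw : w ∈ D n) : t n * w * t n ∈ D n := by
  have key : ∀ a b : SignedPerm n,
      t n * (a * b) * t n = (t n * a * t n) * (t n * b * t n) := by
    intro a b
    have : (t n * a * t n) * (t n * b * t n) = t n * a * (t n * t n) * b * t n := by
      simp only [mul_assoc]
    rw [this, t_mul_t]; simp only [mul_assoc, mul_one]
  unfold D at hw ⊢
  induction hw using Subgroup.closure_induction with
  | mem x hx =>
    rcases hx with ⟨h, rfl⟩ | ⟨i, rfl⟩
    · have : t n * (t n * s ⟨0, h⟩ * t n) * t n = s ⟨0, h⟩ := by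
        have e : t n * (t n * s ⟨0, h⟩ * t n) * t n
            = (t n * t n) * s ⟨0, h⟩ * (t n * t n) := by simp only [mul_assoc]
        rw [e, t_mul_t]; simp
      rw [this]
      exact Subgroup.subset_closure (Or.inr ⟨_, rfl⟩)
    · by_cases hi : (i : ℕ) = 0
      · have h : 0 < n - 1 := by have := i.2; omega
        have : i = ⟨0, h⟩ := Fin.ext hi
        subst this
        exact Subgroup.subset_closure (Or.inl ⟨h, rfl⟩)
      · have : t n * s i * t n = s i := by
          refine SignedPerm.ext (by simp [t]) (funext fun j => ?_)
          have hsw : ((Equiv.swap (⟨i, by omega⟩ : Fin n) ⟨i + 1, by omega⟩ j : Fin n) : ℕ) = 0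
              ↔ (j : ℕ) = 0 := by
            rw [Equiv.swap_apply_def]
            split_ifs with h1 h2
            · subst h1; simp [hi]
            · subst h2; simp [hi]
            · rfl
          simp only [mul_sign, t, s, Equiv.Perm.one_apply, hsw]
          by_cases hj : (j : ℕ) = 0 <;> simp [hj]
        rw [this]
        exact Subgroup.subset_closure (Or.inr ⟨_, rfl⟩)
  | one => rw [mul_one, t_mul_t]; exact Subgroup.one_mem _
  | mul x y _ _ hx hy => rw [key]; exact Subgroup.mul_mem _ hx hy
  | inv x _ hx =>
    have : t n * x⁻¹ * t n = (t n * x * t n)⁻¹ := by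
      have ht : (t n)⁻¹ = t n := inv_eq_of_mul_eq_one_left (t_mul_t n)
      simp only [mul_inv_rev, ht, mul_assoc]
    rw [this]; exact Subgroup.inv_mem _ hx

theorem t_conj_t_conj (w : SignedPerm n) : t n * (t n * w * t n) * t n = w := by
  have e : t n * (t n * w * t n) * t n = (t n * t n) * w * (t n * t n) := by
    simp only [mul_assoc]
  rw [e, t_mul_t]; simp

/-- The automorphism `w ↦ w^⋄ = t w t` of `W_n`. It exchanges `u` and `s_1` and fixes
`s_2, …, s_{n-1}`. -/
def diamond (n : ℕ) : D n ≃* D n where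
  toFun w := ⟨t n * w * t n, t_conj_mem w.2⟩
  invFun w := ⟨t n * w * t n, t_conj_mem w.2⟩
  left_inv w := Subtype.ext (t_conj_t_conj _)
  right_inv w := Subtype.ext (t_conj_t_conj _)
  map_mul' v w := Subtype.ext (by
    change t n * ((v : SignedPerm n) * w) * t n = (t n * v * t n) * (t n * w * t n)
    have e : (t n * (v : SignedPerm n) * t n) * (t n * w * t n)
        = t n * v * (t n * t n) * w * t n := by simp only [mul_assoc]
    rw [e, t_mul_t]; simp only [mul_assoc, mul_one])

/-- The action of `W_n` on `ℤⁿ`. -/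
def dRep (n : ℕ) : Representation ℤ (D n) (Fin n → ℤ) :=
  (reflectionRep n).comp (D n).subtype

/-- The root system of type `D_n`: the vectors `±e_i ± e_j` with `i ≠ j`. -/
def dRoots (n : ℕ) : Set (Fin n → ℤ) :=
  {α | ∃ i j : Fin n, i ≠ j ∧ ∃ a b : ℤˣ,
    α = Pi.single i (a : ℤ) + Pi.single j (b : ℤ)}

/-- The simple roots: `e_1 + e_2` (for `u`) and `e_{i+1} - e_i` (for `s_i`). -/
def dSimpleRoots (n : ℕ) : Set (Fin n → ℤ) :=
  {α | ∃ h : 0 < n - 1, α = Pi.single ⟨0, by omega⟩ 1 + Pi.single ⟨1, by omega⟩ 1} ∪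
  {α | ∃ i : Fin (n - 1), α = Pi.single ⟨i + 1, by omega⟩ 1 - Pi.single ⟨i, by omega⟩ 1}

/-- The positive roots: the roots that are sums of simple roots. -/
def dPosRoots (n : ℕ) : Set (Fin n → ℤ) :=
  {α | α ∈ dRoots n ∧ α ∈ AddSubmonoid.closure (dSimpleRoots n)}

/-- Kottwitz' character `Υ_w^1` of `W_n` (split case: the trivial automorphism). -/
noncomputable def splitCharacter (w : D n) : D n → ℚ :=
  Kottwitz.kottwitzCharacter (MulEquiv.refl (D n)) (dRep n) id (dRoots n) (dPosRoots n) w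

/-- Kottwitz' character `Υ_w^⋄` of `W_n` (quasi-split case: `w^⋄ = t w t`, `α^⋄ = t(α)`). -/
noncomputable def quasiSplitCharacter (w : D n) : D n → ℚ :=
  Kottwitz.kottwitzCharacter (diamond n) (dRep n) (reflectionRep n (t n)) (dRoots n)
    (dPosRoots n) w

/-- The generator `s_i`, as an element of `W_n`. -/
def sD (i : Fin (n - 1)) : D n :=
  ⟨s i, Subgroup.subset_closure (Or.inr ⟨i, rfl⟩)⟩

/-- The element `σ_{n/2} = s_1 s_3 ⋯ s_{n-1}` of `W_n`, for even `n`. -/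
def sigmaHalf (n : ℕ) : D n :=
  (List.ofFn fun k : Fin (n / 2) => sD (n := n) ⟨2 * k, by omega⟩).prod

/-! ### The module attached to a conjugacy class of `B_n` -/

/-- The conjugate `x σ x⁻¹`, as an element of the conjugacy class of `σ`. -/
def conjBy {C : ConjClasses (SignedPerm n)} (x : SignedPerm n) (σ : C.carrier) : C.carrier :=
  ⟨x * σ * x⁻¹, by
    have hσ := ConjClasses.mem_carrier_iff_mk_eq.1 σ.2
    refine ConjClasses.mem_carrier_iff_mk_eq.2 (Eq.trans ?_ hσ)
    rw [ConjClasses.mk_eq_mk_iff_isConj]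
    exact (isConj_iff.2 ⟨x, rfl⟩ : IsConj (σ : SignedPerm n) _).symm⟩

open Classical in
/-- The representation `ρ` on a space with basis `(b_σ)_{σ ∈ C}` is given on the generators by
`t.b_σ = b_{tσt}`; `s_i.b_σ = -b_σ` if `s_i σ = σ s_i` and `ℓ(σ s_i) < ℓ(σ)`, and
`s_i.b_σ = b_{s_i σ s_i}` otherwise. (Recall `t⁻¹ = t` and `s_i⁻¹ = s_i`.) -/
def IsInvolutionModule {C : ConjClasses (SignedPerm n)} {M : Type*} [AddCommGroup M] [Module ℚ M]
    (b : Module.Basis C.carrier ℚ M) (ρ : Representation ℚ (SignedPerm n) M) : Prop :=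
  (∀ σ : C.carrier, ρ (t n) (b σ) = b (conjBy (t n) σ)) ∧
  ∀ (i : Fin (n - 1)) (σ : C.carrier),
    ρ (s i) (b σ) =
      if s i * σ = σ * s i ∧ length ((σ : SignedPerm n) * s i) < length (σ : SignedPerm n)
      then -b σ else b (conjBy (s i) σ)

end SignedPerm

namespace SignedPerm

variable {n : ℕ}

/-! ### Roots and heights -/

/-! The module is monomial, and its signs have a closed form. For a signed permutation `x`, let
`conjSign σ x` be (-1)^k, with k the number of positive roots of type D negated by `σ` that `x`
makes negative. Since `x` carries the roots negated by `σ` to those negated by `xσx⁻¹`, this is a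
cocycle (`conjSign_mul`), so `x.b_σ = conjSign σ x • b_{xσx⁻¹}` defines a representation of the
whole group of type B. It satisfies the required formulas: `t` preserves positivity, and `s_i` makes
only its own simple root negative, which `σ` negates exactly when `s_i` commutes with `σ` and
shortens it (`commute_and_length_lt_iff`). Uniqueness holds because the generators generate.

The character at `g` is therefore the sum of `conjSign σ g` over the `σ` in the class that commute
with `g`. Kottwitz' character is the same sum over the `W_n`-orbit of `σ`, where `σ = w` in the
split case and `σ = tw` in the quasi-split case (`kottwitzCharacter_eq_finsum`): this turns the
twisted centraliser and the set `Φ_w` into untwisted ones.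

It remains to decompose a class into `W_n`-orbits. It is the union of the orbits of `σ` and `tσt`,
and is one orbit if `W_n t` meets the centraliser of `σ`. For `σ` in `W_n t` this is witnessed by
`σ` itself. If the class splits, `σ` cannot fix a coordinate line, so its permutation is a
fixed-point-free involution and `σ` is conjugate to `σ_{n/2}`. -/

theorem reflectionRep_apply (w : SignedPerm n) (v : Fin n → ℤ) (j : Fin n) :
    reflectionRep n w v j = (w.sign (w.perm⁻¹ j) : ℤ) * v (w.perm⁻¹ j) := rfl

theorem reflectionRep_single (w : SignedPerm n) (i : Fin n) (c : ℤ) :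
    reflectionRep n w (Pi.single i c) = Pi.single (w.perm i) ((w.sign i : ℤ) * c) := by
  ext j
  rw [reflectionRep_apply]
  by_cases h : j = w.perm i
  · subst h; simp
  · have h' : w.perm⁻¹ j ≠ i := fun e => h (by rw [← e]; simp)
    rw [Pi.single_eq_of_ne h, Pi.single_eq_of_ne h', mul_zero]

theorem reflectionRep_injective : Function.Injective (reflectionRep n) := by
  intro v w h
  have key : ∀ i, v.perm i = w.perm i ∧ v.sign i = w.sign i := by
    intro i
    have hi := congrArg (fun f => f (Pi.single i 1)) h
    simp only [reflectionRep_single, mul_one] at hi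
    have h1 := congrFun hi (v.perm i)
    rw [Pi.single_eq_same] at h1
    by_cases e : v.perm i = w.perm i
    · rw [e, Pi.single_eq_same] at h1
      exact ⟨e, Units.ext h1⟩
    · rw [Pi.single_eq_of_ne e] at h1
      exact absurd h1 (Units.ne_zero _)
  ext i
  · rw [(key i).1]
  · rw [(key i).2]

theorem reflectionRep_mul_apply (x y : SignedPerm n) (v : Fin n → ℤ) :
    reflectionRep n (x * y) v = reflectionRep n x (reflectionRep n y v) := by
  rw [map_mul]; rfl

@[simp] theorem reflectionRep_inv_apply_apply (x : SignedPerm n) (v : Fin n → ℤ) :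
    reflectionRep n x⁻¹ (reflectionRep n x v) = v := by
  rw [← reflectionRep_mul_apply]; simp

@[simp] theorem reflectionRep_apply_inv_apply (x : SignedPerm n) (v : Fin n → ℤ) :
    reflectionRep n x (reflectionRep n x⁻¹ v) = v := by
  rw [← reflectionRep_mul_apply]; simp

/-- The linear form `e_i ↦ i` (zero-based), which takes the value `1` on each simple root. -/
def height (n : ℕ) : (Fin n → ℤ) →ₗ[ℤ] ℤ := ∑ i : Fin n, (i : ℤ) • LinearMap.proj i

theorem height_apply (v : Fin n → ℤ) : height n v = ∑ i : Fin n, (i : ℤ) * v i := by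
  simp [height]

@[simp] theorem height_single (i : Fin n) (c : ℤ) : height n (Pi.single i c) = i * c := by
  rw [height_apply, Finset.sum_eq_single i] <;> simp +contextual

theorem reflectionRep_mem_dRoots (w : SignedPerm n) {α : Fin n → ℤ} (hα : α ∈ dRoots n) :
    reflectionRep n w α ∈ dRoots n := by
  obtain ⟨i, j, hij, a, b, rfl⟩ := hα
  exact ⟨w.perm i, w.perm j, w.perm.injective.ne hij, w.sign i * a, w.sign j * b, by
    simp [map_add, reflectionRep_single]⟩

theorem neg_mem_dRoots {α : Fin n → ℤ} (hα : α ∈ dRoots n) : -α ∈ dRoots n := by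
  obtain ⟨i, j, hij, a, b, rfl⟩ := hα
  exact ⟨i, j, hij, -a, -b, by simp [Pi.single_neg, add_comm]⟩

theorem height_ne_zero {α : Fin n → ℤ} (hα : α ∈ dRoots n) : height n α ≠ 0 := by
  obtain ⟨i, j, hij, a, b, rfl⟩ := hα
  have : (i : ℕ) ≠ j := Fin.val_ne_of_ne hij
  rcases Int.units_eq_one_or a with rfl | rfl <;> rcases Int.units_eq_one_or b with rfl | rfl <;>
    simp <;> omega

theorem finite_dRoots (n : ℕ) : (dRoots n).Finite := by
  refine (Set.finite_range fun p : (Fin n × Fin n) × (ℤˣ × ℤˣ) =>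
    (Pi.single p.1.1 (p.2.1 : ℤ) + Pi.single p.1.2 (p.2.2 : ℤ) : Fin n → ℤ)).subset ?_
  rintro _ ⟨i, j, -, a, b, rfl⟩
  exact ⟨((i, j), (a, b)), rfl⟩

theorem single_sub_single_mem_closure {i j : ℕ} (hij : i ≤ j) (hj : j < n) :
    (Pi.single ⟨j, hj⟩ 1 - Pi.single ⟨i, by omega⟩ 1 : Fin n → ℤ) ∈
      AddSubmonoid.closure (dSimpleRoots n) := by
  induction j, hij using Nat.le_induction with
  | base => simp
  | succ k hk ih =>
    have h1 := ih (by omega)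
    have h2 : (Pi.single ⟨k + 1, hj⟩ 1 - Pi.single ⟨k, by omega⟩ 1 : Fin n → ℤ) ∈
        AddSubmonoid.closure (dSimpleRoots n) :=
      AddSubmonoid.subset_closure (Or.inr ⟨⟨k, by omega⟩, rfl⟩)
    have := add_mem h2 h1
    rwa [sub_add_sub_cancel] at this

/-- With zero-based indices, e_j + e_i = (e_0 + e_1) + (e_j - e_1) + (e_i - e_0), where j ≥ 1
because i < j. -/
theorem single_add_single_mem_closure {i j : Fin n} (hij : i < j) :
    (Pi.single j 1 + Pi.single i 1 : Fin n → ℤ) ∈ AddSubmonoid.closure (dSimpleRoots n) := by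
  have hij' : (i : ℕ) < j := hij
  have hj := j.2
  have h0 : (Pi.single ⟨0, by omega⟩ 1 + Pi.single ⟨1, by omega⟩ 1 : Fin n → ℤ) ∈
      AddSubmonoid.closure (dSimpleRoots n) :=
    AddSubmonoid.subset_closure (Or.inl ⟨by omega, rfl⟩)
  have h1 := single_sub_single_mem_closure (n := n) (i := 1) (j := j) (by omega) j.2
  have h2 := single_sub_single_mem_closure (n := n) (i := 0) (j := i) (by omega) i.2
  have := add_mem (add_mem h0 h1) h2
  convert this using 1
  simp only [Fin.eta]
  abel

theorem mem_closure_of_height_pos {i j : Fin n} (hij : i < j) (a b : ℤˣ)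
    (h : 0 < height n (Pi.single i (a : ℤ) + Pi.single j (b : ℤ))) :
    (Pi.single i (a : ℤ) + Pi.single j (b : ℤ) : Fin n → ℤ) ∈
      AddSubmonoid.closure (dSimpleRoots n) := by
  have hij' : (i : ℕ) < j := hij
  rcases Int.units_eq_one_or a with rfl | rfl <;> rcases Int.units_eq_one_or b with rfl | rfl
  · rw [add_comm]; exact single_add_single_mem_closure hij
  · simp at h; omega
  · have := single_sub_single_mem_closure (n := n) (i := i) (j := j) hij'.le j.2
    simpa [Pi.single_neg, sub_eq_add_neg, add_comm] using this
  · simp at h; omega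

/-- Simple roots have height 1 and no root has height 0, so positivity becomes the sign of a linear
form. -/
theorem mem_dPosRoots_iff {α : Fin n → ℤ} :
    α ∈ dPosRoots n ↔ α ∈ dRoots n ∧ 0 < height n α := by
  refine and_congr_right fun hα => ⟨fun h => ?_, fun h => ?_⟩
  · refine lt_of_le_of_ne ?_ (height_ne_zero hα).symm
    clear hα
    induction h using AddSubmonoid.closure_induction with
    | mem x hx => rcases hx with ⟨h, rfl⟩ | ⟨i, rfl⟩ <;> simp
    | zero => simp
    | add x y _ _ hx hy => rw [map_add]; exact add_nonneg hx hy
  · obtain ⟨i, j, hij, a, b, rfl⟩ := hα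
    rcases lt_or_gt_of_ne hij with hlt | hlt
    · exact mem_closure_of_height_pos hlt a b h
    · rw [add_comm] at h ⊢
      exact mem_closure_of_height_pos hlt b a h

/-! ### The sign cocycle -/

/-- The roots of positive height that `σ` sends to their negatives. -/
noncomputable def posNegated (σ : SignedPerm n) : Finset (Fin n → ℤ) :=
  ((finite_dRoots n).subset (Set.sep_subset (dRoots n)
    fun α => reflectionRep n σ α = -α ∧ 0 < height n α)).toFinset

theorem mem_posNegated {σ : SignedPerm n} {α : Fin n → ℤ} :
    α ∈ posNegated σ ↔ α ∈ dRoots n ∧ reflectionRep n σ α = -α ∧ 0 < height n α := by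
  simp only [posNegated, Set.Finite.mem_toFinset, Set.mem_ofPred_eq]

/-- The sign `(-1)^k`, with `k` the number of positive roots negated by `σ` that `x` makes
negative. -/
noncomputable def conjSign (σ x : SignedPerm n) : ℚ :=
  ∏ α ∈ posNegated σ, if height n (reflectionRep n x α) < 0 then -1 else 1

theorem conjSign_eq_neg_one_pow (σ x : SignedPerm n) :
    conjSign σ x = (-1) ^ Set.ncard {α | (α ∈ dRoots n ∧ reflectionRep n σ α = -α) ∧
      0 < height n α ∧ height n (reflectionRep n x α) < 0} := by
  have : {α | (α ∈ dRoots n ∧ reflectionRep n σ α = -α) ∧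
      0 < height n α ∧ height n (reflectionRep n x α) < 0} =
      ((posNegated σ).filter fun α => height n (reflectionRep n x α) < 0 : Finset _) := by
    ext α; simp [mem_posNegated, and_assoc]
  rw [this, Set.ncard_coe_finset, conjSign, Finset.prod_ite]
  simp

/-- The positive one of `x α` and `-x α`. -/
def posImage (x : SignedPerm n) (α : Fin n → ℤ) : Fin n → ℤ :=
  if height n (reflectionRep n x α) < 0 then -reflectionRep n x α else reflectionRep n x α

/-- Together with `posImage_inv_posImage`, this gives a bijection between the positive roots negated
by `σ` and those negated by `xσx⁻¹`. -/
theorem posImage_mem {σ x : SignedPerm n} {α : Fin n → ℤ} (hα : α ∈ posNegated σ) :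
    posImage x α ∈ posNegated (x * σ * x⁻¹) := by
  rw [mem_posNegated] at hα ⊢
  have hx := reflectionRep_mem_dRoots x hα.1
  have h0 := height_ne_zero hx
  unfold posImage
  split_ifs with h
  · refine ⟨neg_mem_dRoots hx, ?_, by rw [map_neg]; omega⟩
    simp [hα.2.1]
  · refine ⟨hx, ?_, by omega⟩
    simp [hα.2.1]

theorem posImage_inv_posImage (x : SignedPerm n) {α : Fin n → ℤ} (hα : 0 < height n α) :
    posImage x⁻¹ (posImage x α) = α := by
  unfold posImage
  by_cases h : height n (reflectionRep n x α) < 0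
  · simp [h, hα]
  · simp [h, hα.le]

/-- Up to sign, the passage from α to xyα goes through yα. A sign change at the end means exactly
one of the two steps changed the sign; the step by `x` is counted on the positive representative of
±yα. -/
theorem conjSign_mul (σ x y : SignedPerm n) :
    conjSign σ (x * y) = conjSign (y * σ * y⁻¹) x * conjSign σ y := by
  have hc : ∏ α ∈ posNegated σ,
      (if height n (reflectionRep n x (posImage y α)) < 0 then (-1 : ℚ) else 1) =
      conjSign (y * σ * y⁻¹) x := by
    refine Finset.prod_bij' (fun α _ => posImage y α) (fun α _ => posImage y⁻¹ α)
      (fun α hα => posImage_mem hα) (fun α hα => ?_) (fun α hα => ?_) (fun α hα => ?_)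
      (fun α hα => rfl)
    · have := posImage_mem (x := y⁻¹) hα
      simpa [mul_assoc] using this
    · exact posImage_inv_posImage y (mem_posNegated.1 hα).2.2
    · have := posImage_inv_posImage y⁻¹ (mem_posNegated.1 hα).2.2
      rwa [inv_inv] at this
  rw [← hc, conjSign, conjSign, ← Finset.prod_mul_distrib]
  refine Finset.prod_congr rfl fun α hα => ?_
  have h0 := height_ne_zero (reflectionRep_mem_dRoots (x * y) (mem_posNegated.1 hα).1)
  rw [reflectionRep_mul_apply] at h0 ⊢
  unfold posImage
  by_cases h : height n (reflectionRep n y α) < 0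
  · by_cases h' : height n (reflectionRep n x (reflectionRep n y α)) < 0
    · simp [h, h', h'.le]
    · have : 0 < height n (reflectionRep n x (reflectionRep n y α)) := by omega
      simp [h, h', this]
  · simp [h]

@[simp] theorem conjSign_one (σ : SignedPerm n) : conjSign σ 1 = 1 := by
  refine Finset.prod_eq_one fun α hα => if_neg ?_
  have := (mem_posNegated.1 hα).2.2
  simpa using this.le

/-! ### Generators acting on roots -/

/-- The simple root `e_{i+1} - e_i`. -/
def simpleRoot (i : Fin (n - 1)) : Fin n → ℤ :=
  Pi.single ⟨i + 1, by omega⟩ 1 - Pi.single ⟨i, by omega⟩ 1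

theorem simpleRoot_mem (i : Fin (n - 1)) : simpleRoot i ∈ dRoots n :=
  ⟨⟨i + 1, by omega⟩, ⟨i, by omega⟩, by simp, 1, -1, by
    simp [simpleRoot, Pi.single_neg, sub_eq_add_neg]⟩

@[simp] theorem height_simpleRoot (i : Fin (n - 1)) : height n (simpleRoot i) = 1 := by
  simp [simpleRoot]

/-- The vector whose sign `t` changes has weight 0 in the height. -/
theorem height_t (α : Fin n → ℤ) : height n (reflectionRep n (t n) α) = height n α := by
  rw [height_apply, height_apply]
  refine Finset.sum_congr rfl fun i _ => ?_
  rw [reflectionRep_apply]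
  by_cases h : (i : ℕ) = 0 <;> simp [t, h]

/-- `s_i` acts as the reflection in its simple root. -/
theorem reflectionRep_s (i : Fin (n - 1)) (v : Fin n → ℤ) :
    reflectionRep n (s i) v =
      v - (v ⟨i + 1, by omega⟩ - v ⟨i, by omega⟩) • simpleRoot i := by
  ext j
  rw [reflectionRep_apply]
  by_cases h1 : j = ⟨i, by omega⟩
  · subst h1; simp [s, simpleRoot]
  · by_cases h2 : j = ⟨i + 1, by omega⟩
    · subst h2; simp [s, simpleRoot]
    · simp [s, simpleRoot, Equiv.swap_apply_of_ne_of_ne h1 h2, Pi.single_eq_of_ne h1,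
        Pi.single_eq_of_ne h2]

theorem dotProduct_simpleRoot (v : Fin n → ℤ) (i : Fin (n - 1)) :
    v ⬝ᵥ simpleRoot i = v ⟨i + 1, by omega⟩ - v ⟨i, by omega⟩ := by
  simp [simpleRoot, dotProduct_sub]

theorem dotProduct_reflectionRep (w : SignedPerm n) (u v : Fin n → ℤ) :
    reflectionRep n w u ⬝ᵥ reflectionRep n w v = u ⬝ᵥ v := by
  unfold dotProduct
  rw [← Equiv.sum_comp w.perm]
  refine Finset.sum_congr rfl fun i _ => ?_
  simp only [reflectionRep_apply, ← Equiv.Perm.mul_apply, inv_mul_cancel, Equiv.Perm.one_apply]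
  rcases Int.units_eq_one_or (w.sign i) with h | h <;> simp [h]

/-- Conjugating a reflection by an isometry gives the reflection in the image root, and a root and
its negative define the same reflection. -/
theorem mul_s_eq_s_mul {u : SignedPerm n} {i j : Fin (n - 1)} {c : ℤ} (hc : c * c = 1)
    (h : reflectionRep n u (simpleRoot i) = c • simpleRoot j) : u * s i = s j * u := by
  refine reflectionRep_injective (LinearMap.ext fun v => ?_)
  rw [reflectionRep_mul_apply, reflectionRep_mul_apply, reflectionRep_s, reflectionRep_s,
    ← dotProduct_simpleRoot, ← dotProduct_simpleRoot, map_sub, map_smul, h,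
    ← dotProduct_reflectionRep u v, h, dotProduct_smul, smul_smul]
  congr 2
  rw [smul_eq_mul, mul_right_comm, hc, one_mul]

theorem reflectionRep_s_simpleRoot (i : Fin (n - 1)) :
    reflectionRep n (s i) (simpleRoot i) = -simpleRoot i := by
  have h : simpleRoot i ⟨i + 1, by omega⟩ - simpleRoot i ⟨i, by omega⟩ = 2 := by
    simp [simpleRoot]
  rw [reflectionRep_s, h, two_smul]; abel

theorem eq_simpleRoot {α : Fin n → ℤ} (hα : α ∈ dRoots n) (i : Fin (n - 1))
    (h : α ⟨i + 1, by omega⟩ - α ⟨i, by omega⟩ = 2) : α = simpleRoot i := by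
  obtain ⟨k, l, hkl, a, b, rfl⟩ := hα
  have hne : (⟨i + 1, by omega⟩ : Fin n) ≠ ⟨i, by omega⟩ := by simp
  simp only [Pi.add_apply, Pi.single_apply] at h
  unfold simpleRoot
  generalize (⟨i + 1, by omega⟩ : Fin n) = p at *
  generalize (⟨i, by omega⟩ : Fin n) = q at *
  rcases Int.units_eq_one_or a with rfl | rfl <;> rcases Int.units_eq_one_or b with rfl | rfl <;>
  by_cases h1 : p = k <;> by_cases h2 : p = l <;> by_cases h3 : q = k <;> by_cases h4 : q = l <;>
  simp_all [Pi.single_neg, sub_eq_add_neg, add_comm]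

theorem height_reflectionRep_s (i : Fin (n - 1)) (v : Fin n → ℤ) :
    height n (reflectionRep n (s i) v) =
      height n v - (v ⟨i + 1, by omega⟩ - v ⟨i, by omega⟩) := by
  rw [reflectionRep_s, map_sub, map_smul, height_simpleRoot, smul_eq_mul, mul_one]

theorem dRoots_sub_le_two {α : Fin n → ℤ} (hα : α ∈ dRoots n) {p q : Fin n} (hpq : p ≠ q) :
    α p - α q ≤ 2 := by
  obtain ⟨k, l, hkl, a, b, rfl⟩ := hα
  simp only [Pi.add_apply, Pi.single_apply]
  rcases Int.units_eq_one_or a with rfl | rfl <;> rcases Int.units_eq_one_or b with rfl | rfl <;>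
  split_ifs <;> simp_all

/-- The only positive root made negative by `s_i` is its simple root. -/
theorem eq_simpleRoot_of_height_neg {α : Fin n → ℤ} (hα : α ∈ dRoots n) (i : Fin (n - 1))
    (h1 : 0 < height n α) (h2 : height n (reflectionRep n (s i) α) < 0) : α = simpleRoot i := by
  rw [height_reflectionRep_s] at h2
  have := dRoots_sub_le_two hα (p := ⟨i + 1, by omega⟩) (q := ⟨i, by omega⟩) (by simp)
  -- The height is at least 1 before and negative after, so it drops by at least 2, the largest drop
  -- possible.
  exact eq_simpleRoot hα i (by omega)

theorem s_mul_s (i : Fin (n - 1)) : s i * s i = (1 : SignedPerm n) := by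
  ext j <;> simp [s]

@[simp] theorem t_inv (n : ℕ) : (t n)⁻¹ = t n := inv_eq_of_mul_eq_one_left (t_mul_t n)

@[simp] theorem s_inv (i : Fin (n - 1)) : (s i : SignedPerm n)⁻¹ = s i :=
  inv_eq_of_mul_eq_one_left (s_mul_s i)

theorem conjSign_t (σ : SignedPerm n) : conjSign σ (t n) = 1 := by
  refine Finset.prod_eq_one fun α hα => if_neg ?_
  rw [height_t]
  exact (mem_posNegated.1 hα).2.2.le.not_gt

theorem conjSign_s (σ : SignedPerm n) (i : Fin (n - 1)) :
    conjSign σ (s i) = if reflectionRep n σ (simpleRoot i) = -simpleRoot i then -1 else 1 := by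
  split_ifs with h
  · rw [conjSign, Finset.prod_eq_single (simpleRoot i)]
    · simp [reflectionRep_s_simpleRoot]
    · intro α hα hne
      rw [mem_posNegated] at hα
      exact if_neg fun h' => hne (eq_simpleRoot_of_height_neg hα.1 i hα.2.2 h')
    · intro h'
      exact absurd (mem_posNegated.2 ⟨simpleRoot_mem i, h, by simp⟩) h'
  · refine Finset.prod_eq_one fun α hα => if_neg fun h' => h ?_
    rw [mem_posNegated] at hα
    rw [← eq_simpleRoot_of_height_neg hα.1 i hα.2.2 h']
    exact hα.2.1

/-! ### Generation and length -/

/-- A signed permutation is a permutation times a product of sign changes of single coordinates, and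
each of these is a conjugate of `t` by a transposition. -/
theorem closure_generators (n : ℕ) : Subgroup.closure (generators n) = ⊤ := by
  set H := Subgroup.closure (generators n) with hH
  have ht : t n ∈ H := Subgroup.subset_closure (Or.inl rfl)
  let permHom : Equiv.Perm (Fin n) →* SignedPerm n :=
    { toFun := fun p => ⟨p, fun _ => 1⟩
      map_one' := rfl
      map_mul' := fun p q => by ext <;> simp }
  let signHom : (Fin n → ℤˣ) →* SignedPerm n :=
    { toFun := fun e => ⟨1, e⟩
      map_one' := rfl
      map_mul' := fun p q => by ext <;> simp }
  have hperm : ∀ p, permHom p ∈ H := by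
    intro p
    obtain _ | m := n
    · rw [Subsingleton.elim p 1, map_one]; exact H.one_mem
    · have hp : p ∈ Submonoid.closure
          (Set.range fun i : Fin m => Equiv.swap i.castSucc i.succ) := by
        rw [Equiv.Perm.mclosure_swap_castSucc_succ]; trivial
      induction hp using Submonoid.closure_induction with
      | mem x hx =>
        obtain ⟨i, rfl⟩ := hx
        exact Subgroup.subset_closure (Or.inr ⟨i, rfl⟩)
      | one => rw [map_one]; exact H.one_mem
      | mul x y _ _ hx hy => rw [map_mul]; exact H.mul_mem hx hy
  have hsign : ∀ e, signHom e ∈ H := by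
    intro e
    change e ∈ H.comap signHom
    rw [← Finset.univ_prod_mulSingle e]
    refine Subgroup.prod_mem _ fun i _ => ?_
    change signHom _ ∈ H
    rcases Int.units_eq_one_or (e i) with h | h
    · rw [h, Pi.mulSingle_one, map_one]; exact H.one_mem
    · have hn : 0 < n := i.pos
      have : signHom (Pi.mulSingle i (e i)) =
          permHom (Equiv.swap ⟨0, hn⟩ i) * t n * (permHom (Equiv.swap ⟨0, hn⟩ i))⁻¹ := by
        rw [h]
        ext j
        · simp [signHom, permHom, t]
        · have : (Equiv.swap ⟨0, hn⟩ i j : Fin n).val = 0 ↔ j = i := by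
            rw [show (Equiv.swap ⟨0, hn⟩ i j : Fin n).val = 0 ↔
              Equiv.swap ⟨0, hn⟩ i j = ⟨0, hn⟩ by rw [Fin.ext_iff], Equiv.swap_apply_eq_iff,
              Equiv.swap_apply_left]
          by_cases hj : j = i
          · subst hj
            simp [signHom, permHom, t]
          · simp [signHom, permHom, t, this, hj]
      rw [this]
      exact H.mul_mem (H.mul_mem (hperm _) ht) (H.inv_mem (hperm _))
  refine (Subgroup.eq_top_iff' H).2 fun w => ?_
  have : w = permHom w.perm * signHom w.sign := by ext <;> simp [permHom, signHom]
  rw [this]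
  exact H.mul_mem (hperm _) (hsign _)

theorem exists_word (w : SignedPerm n) :
    ∃ l : List (SignedPerm n), (∀ g ∈ l, g ∈ generators n) ∧ l.prod = w := by
  have hw : w ∈ (Subgroup.closure (generators n)).toSubmonoid := by
    rw [closure_generators]; trivial
  rw [Subgroup.closure_toSubmonoid] at hw
  obtain ⟨l, hl, rfl⟩ := Submonoid.exists_list_of_mem_closure hw
  refine ⟨l, fun g hg => ?_, rfl⟩
  rcases hl g hg with h | h
  · exact h
  · rcases h with h | ⟨i, hi⟩
    · exact Or.inl (by rw [← inv_inv g, show g⁻¹ = t n from h]; simp)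
    · exact Or.inr ⟨i, by rw [← inv_inv g, ← hi]; simp⟩

theorem exists_reduced_word (w : SignedPerm n) :
    ∃ l : List (SignedPerm n), (∀ g ∈ l, g ∈ generators n) ∧ l.prod = w ∧
      l.length = length w := by
  obtain ⟨l, hl, hw⟩ := exists_word w
  exact Nat.sInf_mem (s := {k | ∃ l : List (SignedPerm n), (∀ g ∈ l, g ∈ generators n) ∧
    l.prod = w ∧ l.length = k}) ⟨l.length, l, hl, hw, rfl⟩

theorem length_le (l : List (SignedPerm n)) (hl : ∀ g ∈ l, g ∈ generators n) :
    length l.prod ≤ l.length :=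
  Nat.sInf_le ⟨l, hl, rfl, rfl⟩

/-- The exchange property for the generators `s_i`. -/
theorem exists_word_mul_s (i : Fin (n - 1)) (l : List (SignedPerm n))
    (hl : ∀ g ∈ l, g ∈ generators n)
    (h : height n (reflectionRep n l.prod (simpleRoot i)) < 0) :
    ∃ l' : List (SignedPerm n), (∀ g ∈ l', g ∈ generators n) ∧ l'.prod = l.prod * s i ∧
      l'.length < l.length := by
  induction l with
  | nil => simp at h
  | cons g l ih =>
    simp only [List.mem_cons, forall_eq_or_imp] at hl
    rw [List.prod_cons, reflectionRep_mul_apply] at h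
    have hroot := reflectionRep_mem_dRoots l.prod (simpleRoot_mem i)
    by_cases hneg : height n (reflectionRep n l.prod (simpleRoot i)) < 0
    · obtain ⟨l', h1, h2, h3⟩ := ih hl.2 hneg
      refine ⟨g :: l', ?_, ?_, ?_⟩
      · simpa using ⟨hl.1, h1⟩
      · rw [List.prod_cons, List.prod_cons, h2, mul_assoc]
      · simpa using h3
    · have hpos : 0 < height n (reflectionRep n l.prod (simpleRoot i)) := by
        have := height_ne_zero hroot
        omega
      -- Here the letter `g` itself makes a positive root negative. It cannot be `t`, so it is some
      -- `s j` and the root is the simple root of `j`; then `s j` moves past `l.prod` to become `s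
      -- i` and cancels.
      rcases hl.1 with rfl | ⟨j, rfl⟩
      · rw [height_t] at h; exact absurd h hneg
      · have e := mul_s_eq_s_mul (c := 1) (by norm_num)
          ((eq_simpleRoot_of_height_neg hroot j hpos h).trans (one_smul _ _).symm)
        refine ⟨l, hl.2, ?_, by simp⟩
        rw [List.prod_cons, mul_assoc, e, ← mul_assoc, s_mul_s, one_mul]

theorem length_mul_s_lt {w : SignedPerm n} {i : Fin (n - 1)}
    (h : height n (reflectionRep n w (simpleRoot i)) < 0) : length (w * s i) < length w := by
  obtain ⟨l, hl, rfl, hlen⟩ := exists_reduced_word w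
  obtain ⟨l', hl', hp, hlt⟩ := exists_word_mul_s i l hl h
  rw [← hp]
  exact (length_le l' hl').trans_lt (hlt.trans_eq hlen)

theorem lt_length_mul_s {w : SignedPerm n} {i : Fin (n - 1)}
    (h : 0 < height n (reflectionRep n w (simpleRoot i))) : length w < length (w * s i) := by
  have := length_mul_s_lt (w := w * s i) (i := i) (by
    rw [reflectionRep_mul_apply, reflectionRep_s_simpleRoot, map_neg, map_neg]; omega)
  rwa [mul_assoc, s_mul_s, mul_one] at this

/-- The length drop makes σ(α_i) negative, and commutation makes `s_i` negate it. So -σ(α_i) is a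
positive root made negative by `s_i`, which leaves only α_i. -/
theorem commute_and_length_lt_iff (σ : SignedPerm n) (i : Fin (n - 1)) :
    (s i * σ = σ * s i ∧ length (σ * s i) < length σ) ↔
      reflectionRep n σ (simpleRoot i) = -simpleRoot i := by
  constructor
  · rintro ⟨hc, hl⟩
    have hroot := reflectionRep_mem_dRoots σ (simpleRoot_mem i)
    have hneg : height n (reflectionRep n σ (simpleRoot i)) < 0 := by
      have h0 := height_ne_zero hroot
      by_contra hn
      have := lt_length_mul_s (w := σ) (i := i) (by omega)
      omega
    have hs : reflectionRep n (s i) (reflectionRep n σ (simpleRoot i)) =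
        -reflectionRep n σ (simpleRoot i) := by
      rw [← reflectionRep_mul_apply, hc, reflectionRep_mul_apply, reflectionRep_s_simpleRoot,
        map_neg]
    rw [← neg_eq_iff_eq_neg]
    refine eq_simpleRoot_of_height_neg (neg_mem_dRoots hroot) i (by rw [map_neg]; omega) ?_
    rwa [map_neg, hs, neg_neg]
  · intro h
    refine ⟨(mul_s_eq_s_mul (c := -1) (by norm_num) (by simpa using h)).symm,
      length_mul_s_lt (by rw [h]; simp)⟩

end SignedPerm

/-! ### Induced class functions as sums over orbits -/

namespace Kottwitz

/-- If the fibres of `π : G → X` are the left cosets of `H`, and the summand defining the induced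
class function factors as `F ∘ π`, then the induced class function is the sum of `F` over the
image of `π`. -/
theorem inducedClassFunction_eq_finsum {G X : Type*} [Group G] [Finite G] (H : Subgroup G)
    (ψ : H → ℚ) (g : G) (π : G → X) (hπ : ∀ x y, π y = π x ↔ x⁻¹ * y ∈ H) (F : X → ℚ)
    (hF : ∀ x (h : x⁻¹ * g * x ∈ H), ψ ⟨x⁻¹ * g * x, h⟩ = F (π x))
    (hF' : ∀ x, x⁻¹ * g * x ∉ H → F (π x) = 0) :
    inducedClassFunction H ψ g = ∑ᶠ y ∈ Set.range π, F y := by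
  classical
  have := Fintype.ofFinite G
  -- All fibres have |H| elements, which cancels the factor 1/|H| once the sum is grouped by fibres.
  have hcard : ∀ x, (Finset.univ.filter fun y => π y = π x).card = Nat.card H := by
    intro x
    rw [Nat.card_eq_fintype_card, Fintype.card_subtype]
    refine Finset.card_nbij' (fun y => x⁻¹ * y) (fun z => x * z) ?_ ?_ ?_ ?_ <;>
      intro y hy <;> simp_all
  have h0 : (Nat.card H : ℚ) ≠ 0 := Nat.cast_ne_zero.2 Nat.card_pos.ne'
  rw [inducedClassFunction, finsum_eq_sum_of_fintype,
    finsum_mem_eq_finite_toFinset_sum _ (Set.finite_range π)]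
  have : ∀ x : G, (if h : x⁻¹ * g * x ∈ H then ψ ⟨x⁻¹ * g * x, h⟩ else 0) = F (π x) := by
    intro x
    split_ifs with h
    · exact hF x h
    · exact (hF' x h).symm
  rw [Finset.sum_congr rfl fun x _ => this x, Finset.sum_comp, inv_mul_eq_iff_eq_mul₀ h0,
    Finset.mul_sum]
  refine Finset.sum_congr (by ext; simp) fun y hy => ?_
  obtain ⟨x, rfl⟩ : y ∈ Set.range π := by simpa using hy
  rw [hcard, nsmul_eq_mul]

end Kottwitz

namespace SignedPerm

variable {n : ℕ}

instance : Finite (SignedPerm n) :=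
  Finite.of_injective (fun w : SignedPerm n => (w.perm, w.sign)) fun _ _ h =>
    SignedPerm.ext (congrArg Prod.fst h) (congrArg Prod.snd h)

/-! ### The module with basis a conjugacy class -/

section Module

variable {C : ConjClasses (SignedPerm n)} {M : Type*} [AddCommGroup M] [Module ℚ M]

@[simp] theorem conjBy_one (σ : C.carrier) : conjBy 1 σ = σ := Subtype.ext (by simp [conjBy])

theorem conjBy_mul (x y : SignedPerm n) (σ : C.carrier) :
    conjBy (x * y) σ = conjBy x (conjBy y σ) := Subtype.ext (by simp [conjBy, mul_assoc])

/-- The representation `x ↦ (b_σ ↦ conjSign σ x • b_{xσx⁻¹})`. -/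
noncomputable def involutionRep (b : Module.Basis C.carrier ℚ M) :
    Representation ℚ (SignedPerm n) M where
  toFun x := b.constr ℚ fun σ => conjSign σ x • b (conjBy x σ)
  map_one' := b.ext fun σ => by simp
  map_mul' x y := b.ext fun σ => by
    rw [Module.End.mul_apply]
    simp only [Module.Basis.constr_basis, map_smul, conjBy_mul, conjSign_mul, smul_smul]
    rw [mul_comm]; rfl

theorem involutionRep_apply (b : Module.Basis C.carrier ℚ M) (x : SignedPerm n) (σ : C.carrier) :
    involutionRep b x (b σ) = conjSign σ x • b (conjBy x σ) :=
  b.constr_basis ℚ _ σ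

theorem isInvolutionModule_involutionRep (b : Module.Basis C.carrier ℚ M) :
    IsInvolutionModule b (involutionRep b) := by
  refine ⟨fun σ => by rw [involutionRep_apply, conjSign_t, one_smul], fun i σ => ?_⟩
  rw [involutionRep_apply, conjSign_s]
  by_cases h : reflectionRep n (σ : SignedPerm n) (simpleRoot i) = -simpleRoot i
  · have h' := (commute_and_length_lt_iff (σ : SignedPerm n) i).2 h
    have : conjBy (s i) σ = σ := Subtype.ext (by
      change s i * (σ : SignedPerm n) * (s i)⁻¹ = σ
      rw [h'.1, mul_inv_cancel_right])
    rw [if_pos h, if_pos h', this, neg_one_smul]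
  · rw [if_neg h, if_neg (mt (commute_and_length_lt_iff (σ : SignedPerm n) i).1 h), one_smul]

theorem IsInvolutionModule.eq {b : Module.Basis C.carrier ℚ M}
    {ρ ρ' : Representation ℚ (SignedPerm n) M} (h : IsInvolutionModule b ρ)
    (h' : IsInvolutionModule b ρ') : ρ = ρ' := by
  refine MonoidHom.ext fun w => ?_
  obtain ⟨l, hl, rfl⟩ := exists_word w
  induction l with
  | nil => simp
  | cons g l ih =>
    simp only [List.mem_cons, forall_eq_or_imp] at hl
    rw [List.prod_cons, map_mul, map_mul, ih hl.2]
    congr 1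
    rcases hl.1 with rfl | ⟨i, rfl⟩
    · exact b.ext fun σ => by rw [h.1, h'.1]
    · exact b.ext fun σ => by rw [h.2, h'.2]

open Classical in
/-- The contribution of `σ` to the character value at `g`. -/
noncomputable def fixedTerm (g σ : SignedPerm n) : ℚ :=
  if g * σ = σ * g then conjSign σ g else 0

/-- Each group element acts by a monomial matrix, so only the `σ` fixed under conjugation contribute
to the trace. -/
theorem character_eq_finsum {b : Module.Basis C.carrier ℚ M}
    {ρ : Representation ℚ (SignedPerm n) M} (h : IsInvolutionModule b ρ) (g : SignedPerm n) :
    ρ.character g = ∑ᶠ σ ∈ C.carrier, fixedTerm g σ := by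
  classical
  have := Fintype.ofFinite C.carrier
  rw [h.eq (isInvolutionModule_involutionRep b), ← finsum_set_coe_eq_finsum_mem,
    finsum_eq_sum_of_fintype, Representation.character, LinearMap.trace_eq_matrix_trace ℚ b,
    Matrix.trace]
  refine Finset.sum_congr rfl fun σ _ => ?_
  rw [Matrix.diag_apply, LinearMap.toMatrix_apply, involutionRep_apply, fixedTerm]
  have : g * (σ : SignedPerm n) = σ * g ↔ conjBy g σ = σ := by
    rw [Subtype.ext_iff]
    exact mul_inv_eq_iff_eq_mul.symm
  by_cases hc : conjBy g σ = σ
  · simp [this.2 hc, hc]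
  · simp [mt this.1 hc, hc]

end Module

/-! ### Kottwitz' characters as sums over orbits -/

/-- The orbit of `σ` under conjugation by the group of type `D_n`. -/
def dOrbit (σ : SignedPerm n) : Set (SignedPerm n) :=
  Set.range fun x : D n => (x : SignedPerm n) * σ * (x : SignedPerm n)⁻¹

/-- The hypotheses say that the twisted data of `w` are the untwisted data of `σ`. Cosets of the
centraliser then correspond to points of the orbit, and the cocycle identity transports the sign of
`x⁻¹gx` at `σ` to the sign of `g` at `xσx⁻¹`. -/
theorem kottwitzCharacter_eq_finsum {δ : D n ≃* D n} {θ : (Fin n → ℤ) → Fin n → ℤ} {w : D n}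
    {σ : SignedPerm n}
    (hδ : ∀ x : D n, δ x * w = w * x ↔ (x : SignedPerm n) * σ = σ * x)
    (hθ : ∀ α, dRep n w α = -θ α ↔ reflectionRep n σ α = -α) (g : D n) :
    Kottwitz.kottwitzCharacter δ (dRep n) θ (dRoots n) (dPosRoots n) w g =
      ∑ᶠ τ ∈ dOrbit σ, fixedTerm (g : SignedPerm n) τ := by
  have hmem : ∀ x : D n, x ∈ Kottwitz.twistedCentralizer δ w ↔
      (x : SignedPerm n) * σ = σ * x := hδ
  have hconj : ∀ x : D n, x⁻¹ * g * x ∈ Kottwitz.twistedCentralizer δ w ↔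
      (g : SignedPerm n) * (x * σ * (x : SignedPerm n)⁻¹) =
        x * σ * (x : SignedPerm n)⁻¹ * g := by
    intro x
    rw [hmem]
    simp only [Subgroup.coe_mul, Subgroup.coe_inv]
    constructor
    · intro h
      have := congrArg (fun y => (x : SignedPerm n) * y * (x : SignedPerm n)⁻¹) h
      simpa [mul_assoc] using this
    · intro h
      have := congrArg (fun y => (x : SignedPerm n)⁻¹ * y * (x : SignedPerm n)) h
      simpa [mul_assoc] using this
  have hsign : ∀ x : D n, Kottwitz.kottwitzSign (dRep n) θ (dRoots n) (dPosRoots n) w x =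
      conjSign σ (x : SignedPerm n) := by
    intro x
    rw [Kottwitz.kottwitzSign, conjSign_eq_neg_one_pow]
    congr 2
    ext α
    simp only [Kottwitz.twistedRoots, Set.mem_ofPred_eq, mem_dPosRoots_iff, hθ, map_neg,
      Left.neg_pos_iff]
    constructor
    · rintro ⟨h1, h2, h3⟩
      exact ⟨h1, h2.2, h3.2⟩
    · rintro ⟨h1, h2, h3⟩
      exact ⟨h1, ⟨h1.1, h2⟩,
        neg_mem_dRoots (reflectionRep_mem_dRoots (x : SignedPerm n) h1.1), h3⟩
  refine Kottwitz.inducedClassFunction_eq_finsum _ _ g _ (fun x y => ?_) _ (fun x h => ?_)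
    (fun x h => if_neg (mt (hconj x).2 h))
  · rw [hmem]
    simp only [Subgroup.coe_mul, Subgroup.coe_inv]
    rw [mul_inv_eq_iff_eq_mul, mul_assoc _ _ (y : SignedPerm n), mul_assoc, mul_assoc,
      inv_mul_eq_iff_eq_mul]
  · rw [hsign, fixedTerm, if_pos ((hconj x).1 h)]
    simp only [Subgroup.coe_mul, Subgroup.coe_inv]
    -- The cocycle identity for x⁻¹x = 1: the signs contributed by `x⁻¹` and by `x` cancel.
    have h1 := conjSign_mul σ ((x : SignedPerm n)⁻¹) x
    have h2 : (g : SignedPerm n) * (x * σ * (x : SignedPerm n)⁻¹) * (g : SignedPerm n)⁻¹ =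
        x * σ * (x : SignedPerm n)⁻¹ := by
      rw [(hconj x).1 h, mul_inv_cancel_right]
    rw [inv_mul_cancel, conjSign_one] at h1
    rw [conjSign_mul, conjSign_mul, h2, mul_right_comm, ← h1, one_mul]

theorem splitCharacter_eq_finsum (w g : D n) :
    splitCharacter w g = ∑ᶠ τ ∈ dOrbit (w : SignedPerm n), fixedTerm (g : SignedPerm n) τ :=
  kottwitzCharacter_eq_finsum (fun x => by
    rw [MulEquiv.refl_apply, Subtype.ext_iff]; rfl) (fun _ => Iff.rfl) g

/-- Left multiplication by `t` turns (txt)w = wx into x(tw) = (tw)x, and w(α) = -t(α) into tw(α) =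
-α. -/
theorem quasiSplitCharacter_eq_finsum (w g : D n) :
    quasiSplitCharacter w g = ∑ᶠ τ ∈ dOrbit (t n * (w : SignedPerm n)), fixedTerm (g : SignedPerm n) τ := by
  refine kottwitzCharacter_eq_finsum (fun x => ?_) (fun α => ?_) g
  · rw [Subtype.ext_iff]
    change t n * (x : SignedPerm n) * t n * (w : SignedPerm n) = (w : SignedPerm n) * x ↔
      (x : SignedPerm n) * (t n * w) = t n * w * x
    constructor
    · intro h
      have := congrArg (fun y => t n * y) h
      simpa [← mul_assoc, t_mul_t] using this
    · intro h
      have := congrArg (fun y => t n * y) h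
      simpa [← mul_assoc, t_mul_t] using this
  · change reflectionRep n (w : SignedPerm n) α = -reflectionRep n (t n) α ↔ _
    rw [reflectionRep_mul_apply]
    constructor
    · intro h
      rw [h, map_neg, ← reflectionRep_mul_apply, t_mul_t, map_one]; rfl
    · intro h
      have := congrArg (reflectionRep n (t n)) h
      rwa [map_neg, ← reflectionRep_mul_apply, t_mul_t, map_one] at this

/-! ### Conjugacy under the two groups -/

theorem s_mem_D (i : Fin (n - 1)) : (s i : SignedPerm n) ∈ D n :=
  Subgroup.subset_closure (Or.inr ⟨i, rfl⟩)

theorem mem_D_or (x : SignedPerm n) : x ∈ D n ∨ x * t n ∈ D n := by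
  obtain ⟨l, hl, rfl⟩ := exists_word x
  induction l with
  | nil => exact Or.inl (D n).one_mem
  | cons g l ih =>
    simp only [List.mem_cons, forall_eq_or_imp] at hl
    rw [List.prod_cons]
    rcases hl.1 with rfl | ⟨i, rfl⟩
    · rcases ih hl.2 with h | h
      · exact Or.inr (t_conj_mem h)
      · left
        have := t_conj_mem h
        rwa [mul_assoc, mul_assoc, t_mul_t, mul_one] at this
    · rcases ih hl.2 with h | h
      · exact Or.inl ((D n).mul_mem (s_mem_D i) h)
      · exact Or.inr (by rw [mul_assoc]; exact (D n).mul_mem (s_mem_D i) h)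

theorem mem_conjugatesOf_iff {G : Type*} [Group G] {a b : G} :
    b ∈ conjugatesOf a ↔ ∃ c, c * a * c⁻¹ = b := isConj_iff

/-- If some element of the coset `W_n t` centralises `σ`, then the class of `σ` is a single orbit
of `W_n`. -/
theorem dOrbit_eq_of_commute {σ c : SignedPerm n} (hc : c * t n ∈ D n) (h : c * σ = σ * c) :
    dOrbit σ = conjugatesOf σ := by
  ext τ
  rw [mem_conjugatesOf_iff]
  constructor
  · rintro ⟨x, rfl⟩
    exact ⟨x, rfl⟩
  · rintro ⟨x, rfl⟩
    rcases mem_D_or x with hx | hx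
    · exact ⟨⟨x, hx⟩, rfl⟩
    -- xc⁻¹ = (xt)(ct)⁻¹ lies in `W_n` and conjugates `σ` as `x` does.
    · refine ⟨⟨x * c⁻¹, ?_⟩, ?_⟩
      · have := (D n).mul_mem hx ((D n).inv_mem hc)
        rwa [mul_inv_rev, mul_assoc, mul_inv_cancel_left] at this
      · have h' : c⁻¹ * σ * c = σ := by rw [mul_assoc, ← h, inv_mul_cancel_left]
        simp only [mul_inv_rev, inv_inv]
        calc x * c⁻¹ * σ * (c * x⁻¹) = x * (c⁻¹ * σ * c) * x⁻¹ := by simp only [mul_assoc]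
          _ = x * σ * x⁻¹ := by rw [h']

theorem conjugatesOf_eq_union (σ : SignedPerm n) :
    conjugatesOf σ = dOrbit σ ∪ dOrbit (t n * σ * t n) := by
  ext τ
  rw [mem_conjugatesOf_iff]
  constructor
  · rintro ⟨x, rfl⟩
    rcases mem_D_or x with hx | hx
    · exact Or.inl ⟨⟨x, hx⟩, rfl⟩
    · refine Or.inr ⟨⟨x * t n, hx⟩, ?_⟩
      simp only [mul_inv_rev, t_inv]
      calc x * t n * (t n * σ * t n) * (t n * x⁻¹)
          = x * (t n * (t n * σ * t n) * t n) * x⁻¹ := by simp only [mul_assoc]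
        _ = x * σ * x⁻¹ := by rw [t_conj_t_conj]
  · rintro (⟨x, rfl⟩ | ⟨x, rfl⟩)
    · exact ⟨x, rfl⟩
    · exact ⟨x * t n, by simp [mul_assoc]⟩

theorem dOrbit_disjoint_or_eq (σ τ : SignedPerm n) :
    Disjoint (dOrbit σ) (dOrbit τ) ∨ τ ∈ dOrbit σ := by
  by_cases h : Disjoint (dOrbit σ) (dOrbit τ)
  · exact Or.inl h
  · obtain ⟨_, ⟨x, rfl⟩, ⟨y, hy⟩⟩ := Set.not_disjoint_iff.1 h
    refine Or.inr ⟨y⁻¹ * x, ?_⟩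
    have := congrArg (fun z => (y : SignedPerm n)⁻¹ * z * y) hy
    simpa [mul_assoc] using this.symm

theorem image_conjugatesOf (w : D n) :
    ((↑) : D n → SignedPerm n) '' conjugatesOf w = dOrbit (w : SignedPerm n) := by
  ext τ
  constructor
  · rintro ⟨v, hv, rfl⟩
    obtain ⟨x, rfl⟩ := mem_conjugatesOf_iff.1 hv
    exact ⟨x, rfl⟩
  · rintro ⟨x, rfl⟩
    exact ⟨x * w * x⁻¹, mem_conjugatesOf_iff.2 ⟨x, rfl⟩, rfl⟩

theorem isConj_of_mem_dOrbit {v w : D n} (h : (w : SignedPerm n) ∈ dOrbit (v : SignedPerm n)) :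
    IsConj v w := by
  obtain ⟨x, hx⟩ := h
  exact isConj_iff.2 ⟨x, Subtype.ext hx⟩

theorem carrier_eq_conjugatesOf {C : ConjClasses (SignedPerm n)} {σ : SignedPerm n}
    (h : σ ∈ C.carrier) : C.carrier = conjugatesOf σ := by
  rw [ConjClasses.mem_carrier_iff_mk_eq] at h
  subst h
  ext τ
  rw [ConjClasses.mem_carrier_iff_mk_eq, ConjClasses.mk_eq_mk_iff_isConj, isConj_comm]
  rfl

theorem dOrbit_eq_of_mem {σ τ : SignedPerm n} (h : τ ∈ dOrbit σ) : dOrbit τ = dOrbit σ := by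
  obtain ⟨x, rfl⟩ := h
  ext ρ
  constructor
  · rintro ⟨y, rfl⟩
    exact ⟨y * x, by simp [mul_assoc]⟩
  · rintro ⟨y, rfl⟩
    exact ⟨y * x⁻¹, by simp [mul_assoc]⟩

/-! ### Classes that split -/

theorem conj_t_mul_t_mem (x : SignedPerm n) : x * t n * x⁻¹ * t n ∈ D n := by
  rcases mem_D_or x with h | h
  · have := (D n).mul_mem h (t_conj_mem ((D n).inv_mem h))
    simpa only [mul_assoc] using this
  · have := (D n).mul_mem h (t_conj_mem ((D n).inv_mem h))
    simpa [mul_assoc, ← mul_assoc (t n) (t n), t_mul_t] using this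

/-- If the permutation underlying `σ` has a fixed point, then some element of `W_n t`
centralises `σ`. -/
theorem exists_commute_of_fixed {σ : SignedPerm n} {i : Fin n} (hi : σ.perm i = i) :
    ∃ c, c * t n ∈ D n ∧ c * σ = σ * c := by
  have hn : 0 < n := i.pos
  -- The sign change of the fixed coordinate, a conjugate of `t`.
  refine ⟨⟨1, fun j => if j = i then -1 else 1⟩, ?_, ?_⟩
  · convert conj_t_mul_t_mem (⟨Equiv.swap ⟨0, hn⟩ i, fun _ => 1⟩ : SignedPerm n) using 2
    ext j
    · simp [t]
    · have : (Equiv.swap ⟨0, hn⟩ i j : Fin n).val = 0 ↔ j = i := by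
        rw [show (Equiv.swap ⟨0, hn⟩ i j : Fin n).val = 0 ↔
          Equiv.swap ⟨0, hn⟩ i j = ⟨0, hn⟩ by rw [Fin.ext_iff], Equiv.swap_apply_eq_iff,
          Equiv.swap_apply_left]
      by_cases hj : j = i <;> simp [t, this, hj]
  · have h : ∀ j, σ.perm j = i ↔ j = i := fun j => by
      conv_lhs => rw [← hi]
      exact σ.perm.injective.eq_iff
    ext j
    · simp
    · by_cases hj : j = i <;> simp [h, hj]

theorem sigmaHalf_partial (m : ℕ) (hm : m ≤ n / 2) (j : Fin n) :
    let w : SignedPerm n := ((List.ofFn fun k : Fin m => sD (n := n) ⟨2 * k, by omega⟩).prod : D n)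
    w.sign j = 1 ∧
      (w.perm j : ℕ) = if (j : ℕ) < 2 * m then (if (j : ℕ) % 2 = 0 then (j : ℕ) + 1 else (j : ℕ) - 1)
        else (j : ℕ) := by
  induction m generalizing j with
  | zero => simp
  | succ m ih =>
    have ih' := fun j => ih (by omega) j
    simp only [List.ofFn_succ', List.concat_eq_append, List.prod_append, List.prod_singleton,
      Subgroup.coe_mul, mul_perm, mul_sign, Equiv.Perm.mul_apply, Fin.val_castSucc] at ih' ⊢
    rw [(ih' _).1, (ih' _).2]
    refine ⟨one_mul _, ?_⟩
    have hs : ((sD ⟨2 * m, by omega⟩ : D n) : SignedPerm n).perm j =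
      if (j : ℕ) = 2 * m then ⟨2 * m + 1, by omega⟩ else
        if (j : ℕ) = 2 * m + 1 then ⟨2 * m, by omega⟩ else j := by
      change Equiv.swap _ _ j = _
      simp [Equiv.swap_apply_def, Fin.ext_iff]
    simp only [Fin.val_last]
    rw [hs]
    split_ifs <;> simp_all <;> omega

theorem sigmaHalf_sign (j : Fin n) : (sigmaHalf n : SignedPerm n).sign j = 1 :=
  (sigmaHalf_partial (n / 2) le_rfl j).1

theorem sigmaHalf_perm (j : Fin n) : ((sigmaHalf n : SignedPerm n).perm j : ℕ) =
    if (j : ℕ) < 2 * (n / 2) then (if (j : ℕ) % 2 = 0 then (j : ℕ) + 1 else (j : ℕ) - 1)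
        else (j : ℕ) :=
  (sigmaHalf_partial (n / 2) le_rfl j).2

theorem cycleType_of_fixedPointFree {p : Equiv.Perm (Fin n)} (hp : p * p = 1)
    (hfix : ∀ i, p i ≠ i) :
    Even n ∧ p.cycleType = Multiset.replicate (n / 2) 2 := by
  have h := Equiv.Perm.cycleType_of_pow_prime_eq_one (p := 2) (by rwa [pow_two])
  have hs : p.support = Finset.univ := by ext i; simp [hfix]
  have hsum := p.sum_cycleType
  rw [hs, Finset.card_univ, Fintype.card_fin, h, Multiset.sum_replicate, smul_eq_mul] at hsum
  refine ⟨⟨p.cycleType.card, by omega⟩, ?_⟩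
  rw [h]
  congr 1
  omega

/-- The permutations are conjugate by cycle type. Since σ² = 1, the two signs on each 2-cycle agree,
so negating at most one of its two basis vectors removes them. -/
theorem even_and_isConj_sigmaHalf {σ : SignedPerm n} (hσ : σ * σ = 1)
    (hfix : ∀ i, σ.perm i ≠ i) : Even n ∧ IsConj σ (sigmaHalf n : SignedPerm n) := by
  have hp : σ.perm * σ.perm = 1 := congrArg perm hσ
  obtain ⟨hn, hc⟩ := cycleType_of_fixedPointFree hp hfix
  refine ⟨hn, ?_⟩
  have hn2 : 2 * (n / 2) = n := Nat.two_mul_div_two_of_even hn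
  have hc' := (cycleType_of_fixedPointFree (p := (sigmaHalf n : SignedPerm n).perm)
    (by
      ext j
      have hj := j.2
      rw [Equiv.Perm.mul_apply, sigmaHalf_perm, sigmaHalf_perm, hn2]
      simp only [Equiv.Perm.one_apply]
      split_ifs <;> omega)
    (fun j h => by
      have hj := j.2
      have := sigmaHalf_perm j
      rw [h, hn2] at this
      split_ifs at this <;> omega)).2
  obtain ⟨c, hcc⟩ := isConj_iff.1 (Equiv.Perm.isConj_iff_cycleType_eq.2 (hc.trans hc'.symm))
  have hpp : ∀ i, σ.perm (σ.perm i) = i := fun i => congrArg (fun p => p i) hp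
  have hss : ∀ i, σ.sign (σ.perm i) * σ.sign i = 1 := fun i =>
    congrArg (fun w => sign w i) hσ
  -- The larger index of each 2-cycle carries the sign correction.
  refine isConj_iff.2 ⟨⟨c, fun i => if i < σ.perm i then 1 else σ.sign i⟩, ?_⟩
  rw [mul_inv_eq_iff_eq_mul]
  refine SignedPerm.ext (mul_inv_eq_iff_eq_mul.1 hcc) (funext fun i => ?_)
  simp only [mul_sign, sigmaHalf_sign, hpp, one_mul]
  rcases lt_or_gt_of_ne (hfix i) with h | h
  · simp [h, h.le]
  · simp [h, h.le, hss]

/-- Two non-conjugate members prevent any `W_n`-orbit from filling the class. This excludes fixed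
points of the permutation and keeps the orbits of `σ_{n/2}` and its image under `t` disjoint. -/
theorem character_eq_split_add_split {C : ConjClasses (SignedPerm n)}
    (hC : ∀ σ ∈ C.carrier, σ * σ = 1) {w₁ w₂ : D n} (hw : ¬ IsConj w₁ w₂)
    (h₁ : (w₁ : SignedPerm n) ∈ C.carrier) (h₂ : (w₂ : SignedPerm n) ∈ C.carrier) :
    Even n ∧ ∀ g : D n, ∑ᶠ σ ∈ C.carrier, fixedTerm (g : SignedPerm n) σ =
      splitCharacter (sigmaHalf n) g + splitCharacter (diamond n (sigmaHalf n)) g := by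
  have hsplit : ∀ σ : SignedPerm n, dOrbit σ ≠ C.carrier := by
    intro σ h
    rw [← h] at h₁ h₂
    rw [← dOrbit_eq_of_mem h₁] at h₂
    exact hw (isConj_of_mem_dOrbit h₂)
  obtain ⟨hn, hconj⟩ := even_and_isConj_sigmaHalf (hC _ h₁) fun i hi => by
    obtain ⟨c, hc, hcomm⟩ := exists_commute_of_fixed hi
    exact hsplit w₁ ((dOrbit_eq_of_commute hc hcomm).trans (carrier_eq_conjugatesOf h₁).symm)
  refine ⟨hn, fun g => ?_⟩
  have hunion : C.carrier = dOrbit (sigmaHalf n : SignedPerm n) ∪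
      dOrbit (diamond n (sigmaHalf n) : SignedPerm n) := by
    rw [carrier_eq_conjugatesOf h₁, hconj.conjugatesOf_eq]
    exact conjugatesOf_eq_union _
  have hdisj : Disjoint (dOrbit (sigmaHalf n : SignedPerm n))
      (dOrbit (diamond n (sigmaHalf n) : SignedPerm n)) := by
    refine (dOrbit_disjoint_or_eq _ _).resolve_right fun h => ?_
    rw [dOrbit_eq_of_mem h, Set.union_self] at hunion
    exact hsplit _ hunion.symm
  rw [splitCharacter_eq_finsum, splitCharacter_eq_finsum, hunion]
  exact finsum_mem_union hdisj (Set.toFinite _) (Set.toFinite _)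

/-! ### Classes in the coset `W_n t` -/

theorem exists_twistedConjClass {C : ConjClasses (SignedPerm n)}
    (hC : ∀ σ ∈ C.carrier, σ * σ = 1)
    (hCt : ∀ σ ∈ C.carrier, ∃ w ∈ D n, σ = w * t n) :
    ∃ K : Set (D n),
      ((↑) : D n → SignedPerm n) '' K = (fun σ => t n * σ) '' C.carrier ∧
      Kottwitz.IsTwistedConjClass (diamond n) K ∧
      (∀ w ∈ K, Kottwitz.IsTwistedInvolution (diamond n) w) ∧
      ∀ w ∈ K, ∀ g : D n, ∑ᶠ σ ∈ C.carrier, fixedTerm (g : SignedPerm n) σ =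
        quasiSplitCharacter w g := by
  have htt : ∀ x : SignedPerm n, t n * (t n * x) = x := fun x => by
    rw [← mul_assoc, t_mul_t, one_mul]
  have hmem : ∀ σ ∈ C.carrier, t n * σ ∈ D n := by
    intro σ hσ
    obtain ⟨w, hw, rfl⟩ := hCt σ hσ
    rw [← mul_assoc]
    exact t_conj_mem hw
  have horbit : ∀ σ ∈ C.carrier, dOrbit σ = C.carrier := by
    intro σ hσ
    obtain ⟨w, hw, rfl⟩ := hCt σ hσ
    rw [carrier_eq_conjugatesOf hσ]
    -- The element of `W_n t` that centralises σ is σ itself.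
    exact dOrbit_eq_of_commute (by rwa [mul_assoc, t_mul_t, mul_one]) rfl
  refine ⟨{w | t n * (w : SignedPerm n) ∈ C.carrier}, ?_, ?_, ?_, ?_⟩
  · ext τ
    constructor
    · rintro ⟨w, hw, rfl⟩
      exact ⟨t n * w, hw, htt _⟩
    · rintro ⟨σ, hσ, rfl⟩
      exact ⟨⟨t n * σ, hmem σ hσ⟩, by simpa [htt] using hσ, rfl⟩
  · obtain ⟨σ, rfl⟩ := C.exists_rep
    have hσ : σ ∈ (ConjClasses.mk σ).carrier := ConjClasses.mem_carrier_mk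
    refine ⟨⟨t n * σ, hmem σ hσ⟩, Set.ext fun w => ?_⟩
    change t n * (w : SignedPerm n) ∈ (ConjClasses.mk σ).carrier ↔ ∃ x : D n, _
    rw [← horbit σ hσ]
    refine exists_congr fun x => ?_
    rw [Subtype.ext_iff]
    change (x : SignedPerm n) * σ * (x : SignedPerm n)⁻¹ = t n * w ↔
      (w : SignedPerm n) = t n * x * t n * (t n * σ) * (x : SignedPerm n)⁻¹
    rw [mul_assoc (t n * (x : SignedPerm n)), htt, mul_assoc (t n), mul_assoc (t n)]
    constructor
    · intro h; rw [h, htt]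
    · intro h; rw [h, htt]
  -- The condition (twt)w = 1 is the same as (tw)² = 1.
  · intro w hw
    refine Subtype.ext (eq_inv_of_mul_eq_one_left ?_)
    change t n * w * t n * (w : SignedPerm n) = 1
    rw [mul_assoc]
    exact hC _ hw
  · intro w hw g
    rw [quasiSplitCharacter_eq_finsum, horbit _ hw]

end SignedPerm

theorem lemma4p3 (n : ℕ) (C : ConjClasses (SignedPerm n))
    (hC : ∀ σ ∈ C.carrier, σ * σ = 1)
    {M : Type*} [AddCommGroup M] [Module ℚ M] (b : Module.Basis C.carrier ℚ M) :
    (∃! ρ : Representation ℚ (SignedPerm n) M, SignedPerm.IsInvolutionModule b ρ) ∧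
    ∀ ρ : Representation ℚ (SignedPerm n) M, SignedPerm.IsInvolutionModule b ρ →
      -- (a)
      (∀ w : SignedPerm.D n,
        C.carrier = ((↑) : SignedPerm.D n → SignedPerm n) '' conjugatesOf w →
        ∀ g : SignedPerm.D n, ρ.character g = SignedPerm.splitCharacter w g) ∧
      -- (b)
      (∀ w₁ w₂ : SignedPerm.D n, ¬ IsConj w₁ w₂ →
        C.carrier = ((↑) : SignedPerm.D n → SignedPerm n) '' (conjugatesOf w₁ ∪ conjugatesOf w₂) →
        Even n ∧ ∀ g : SignedPerm.D n, ρ.character g =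
          SignedPerm.splitCharacter (SignedPerm.sigmaHalf n) g +
          SignedPerm.splitCharacter (SignedPerm.diamond n (SignedPerm.sigmaHalf n)) g) ∧
      -- (c)
      ((∀ σ ∈ C.carrier, ∃ w ∈ SignedPerm.D n, σ = w * SignedPerm.t n) →
        ∃ K : Set (SignedPerm.D n),
          ((↑) : SignedPerm.D n → SignedPerm n) '' K =
            (fun σ => SignedPerm.t n * σ) '' C.carrier ∧
          Kottwitz.IsTwistedConjClass (SignedPerm.diamond n) K ∧
          (∀ w ∈ K, Kottwitz.IsTwistedInvolution (SignedPerm.diamond n) w) ∧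
          ∀ w ∈ K, ∀ g : SignedPerm.D n,
            ρ.character g = SignedPerm.quasiSplitCharacter w g) := by
  refine ⟨⟨SignedPerm.involutionRep b, SignedPerm.isInvolutionModule_involutionRep b,
    fun ρ hρ => hρ.eq (SignedPerm.isInvolutionModule_involutionRep b)⟩, fun ρ hρ => ⟨?_, ?_, ?_⟩⟩
  · intro w hw g
    rw [SignedPerm.character_eq_finsum hρ, SignedPerm.splitCharacter_eq_finsum, hw,
      SignedPerm.image_conjugatesOf]
  · intro w₁ w₂ hne hw
    simp only [SignedPerm.character_eq_finsum hρ]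
    exact SignedPerm.character_eq_split_add_split hC hne
      (hw ▸ ⟨w₁, Or.inl (IsConj.refl w₁), rfl⟩) (hw ▸ ⟨w₂, Or.inr (IsConj.refl w₂), rfl⟩)
  · intro hCt
    simp only [SignedPerm.character_eq_finsum hρ]
    exact SignedPerm.exists_twistedConjClass hC hCt
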